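/- Let $(N^{m+1},h)$ be a smooth Riemannian manifold with non-positive Ricci curvature, $\mathrm{Ric}^N(u,u)\le 0$ for all $u\in TN$, let $(M^m,g)$ be a smooth $m$-dimensional Riemannian manifold, and let $\phi:(M,g)\to(N,h)$ be a smooth isometric immersion (so $M$ is a hypersurface in $N$). Let $B$ be its second fundamental form and $\mathbf H=\frac1m\sum_{i=1}^m B(e_i,e_i)$ its mean curvature vector field, where $\{e_i\}$ denotes a local orthonormal frame of $M$. Suppose that $M$ is a non-negative biminimal hypersurface, that is, for some real constant $\lambda\ge 0$, $$\Big[-\Delta^{\phi}\mathbf H-\sum_{i=1}^m R^N(\mathbf H,d\phi(e_i))\,d\phi(e_i)\Big]^{\perp}+\lambda\,\mathbf H=0\quad\text{on } M .$$ Here $\nabla^\phi$ is the pull-back by $\phi$ of the Levi-Civita connection of $N$, $\nabla$ is the Levi-Civita connection of $M$, $\Delta^\phi V=\sum_i(\nabla^\phi_{e_i}\nabla^\phi_{e_i}V-\nabla^\phi_{\nabla_{e_i}e_i}V)$ for vector fields $V$ along $\phi$, $R^N(X,Y)Z=\nabla^N_X\nabla^N_YZ-\nabla^N_Y\nabla^N_XZ-\nabla^N_{[X,Y]}Z$,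 $\mathrm{Ric}^N(u,u)=\sum_a h(R^N(E_a,u)u,E_a)$ for an orthonormal basis $\{E_a\}$ of the tangent space of $N$, and $[\cdot]^\perp$ is the component normal to $d\phi(TM)$. Then $|\mathbf H|^2$ is a smooth function on $M$ and $$\Delta|\mathbf H|^2\ \ge\ 2m\,|\mathbf H|^4\quad\text{at every point of } M,$$ where $\Delta$ is the (non-positive) Laplace–Beltrami operator of $(M,g)$. -/

import Mathlib

open scoped Manifold ContDiff Bundle

noncomputable section

namespace RiemLocal

/-! ### Coordinate expressions

Here `E` and `F` play the role of coordinate spaces. `g` and `G` are metrics given by their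
coordinate expressions, `f` is the coordinate expression of a map and `V` that of a vector field
along it. -/

variable {E : Type*} [NormedAddCommGroup E] [NormedSpace ℝ E]
  {F : Type*} [NormedAddCommGroup F] [NormedSpace ℝ F]

/-- Christoffel symbols of the Levi-Civita connection of the metric `g`, as a vector: at the point
`y`, `christoffel g y u v` is the vector `Γ(u, v)` with
`g (Γ(u, v), w) = (1/2) (D_u g (v, w) + D_v g (u, w) - D_w g (u, v))` for all `w`.
It is the value at `y` of `∇_u v` for constant vector fields `u` and `v`. -/
def christoffel (g : E → E →L[ℝ] E →L[ℝ] ℝ) (y u v : E) : E :=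
  (g y).inverse ((1 / 2 : ℝ) •
    (fderiv ℝ g y u v + fderiv ℝ g y v u - ((fderiv ℝ g y).flip u).flip v))

/-- The curvature `R(u, v) w = ∇_u ∇_v w - ∇_v ∇_u w` of the metric `g` at `y`, computed on constant
vector fields `u`, `v`, `w` (whose Lie brackets vanish). -/
def curvature (g : E → E →L[ℝ] E →L[ℝ] ℝ) (y u v w : E) : E :=
  fderiv ℝ (fun z ↦ christoffel g z v w) y u - fderiv ℝ (fun z ↦ christoffel g z u w) y v
    + christoffel g y u (christoffel g y v w) - christoffel g y v (christoffel g y u w)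

/-- The covariant derivative `∇^f_u V` at `y` of a vector field `V` along the map `f : E → F`, for
the connection pulled back by `f` from the Levi-Civita connection of the metric `G` of the
target. -/
def covDerivAlong (G : F → F →L[ℝ] F →L[ℝ] ℝ) (f V : E → F) (y u : E) : F :=
  fderiv ℝ V y u + christoffel G (f y) (fderiv ℝ f y u) (V y)

/-- The second covariant derivative `∇^f_u ∇^f_v V - ∇^f_{∇_u v} V` at `y` of a vector field `V`
along `f` (for constant vector fields `u` and `v` on the source). -/
def covDerivAlong₂ (g : E → E →L[ℝ] E →L[ℝ] ℝ) (G : F → F →L[ℝ] F →L[ℝ] ℝ) (f V : E → F)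
    (y u v : E) : F :=
  covDerivAlong G f (fun z ↦ covDerivAlong G f V z v) y u
    - covDerivAlong G f V y (christoffel g y u v)

/-- The second fundamental form `∇^f_u (df v) - df (∇_u v)` at `y` (Gauss formula). -/
def secondForm (g : E → E →L[ℝ] E →L[ℝ] ℝ) (G : F → F →L[ℝ] F →L[ℝ] ℝ) (f : E → F)
    (y u v : E) : F :=
  covDerivAlong G f (fun z ↦ fderiv ℝ f z v) y u - fderiv ℝ f y (christoffel g y u v)

/-- The Hessian `u (v (r)) - (∇_u v) (r)` at `y` of a real function `r`. -/
def hessian (g : E → E →L[ℝ] E →L[ℝ] ℝ) (r : E → ℝ) (y u v : E) : ℝ :=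
  fderiv ℝ (fun z ↦ fderiv ℝ r z v) y u - fderiv ℝ r y (christoffel g y u v)

end RiemLocal

namespace Riem

/-! ### Riemannian manifolds and maps between them

Every tensor at a point `x` is computed in the preferred chart `extChartAt I x` at `x`. The
derivative at `x` of that chart is the identity of `TangentSpace I x = E`, so that tangent vectors
at `x` are their own coordinates. -/

variable {E : Type*} [NormedAddCommGroup E] [NormedSpace ℝ E] [FiniteDimensional ℝ E]
  {H : Type*} [TopologicalSpace H] (I : ModelWithCorners ℝ E H)
  {M : Type*} [TopologicalSpace M] [ChartedSpace H M] [IsManifold I ∞ M]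
  [Bundle.RiemannianBundle (fun x : M ↦ TangentSpace I x)]
  {F : Type*} [NormedAddCommGroup F] [NormedSpace ℝ F] [FiniteDimensional ℝ F]
  {H' : Type*} [TopologicalSpace H'] (J : ModelWithCorners ℝ F H')
  {N : Type*} [TopologicalSpace N] [ChartedSpace H' N] [IsManifold J ∞ N]
  [Bundle.RiemannianBundle (fun p : N ↦ TangentSpace J p)]

instance instFiniteDimensionalTangentSpace (x : M) : FiniteDimensional ℝ (TangentSpace I x) :=
  inferInstanceAs (FiniteDimensional ℝ E)

/-- The coordinate expression of the Riemannian metric of `M` in the chart at `x`. -/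
def metricInChart (x : M) (y : E) : E →L[ℝ] E →L[ℝ] ℝ :=
  let D : E →L[ℝ] TangentSpace I ((extChartAt I x).symm y) :=
    mfderiv 𝓘(ℝ, E) I (extChartAt I x).symm y
  (innerSL ℝ : TangentSpace I ((extChartAt I x).symm y) →L[ℝ] _ →L[ℝ] ℝ).bilinearComp D D

/-- The Riemann curvature tensor `R(u, v) w` at `x`, with the sign
`R(X, Y) Z = ∇_X ∇_Y Z - ∇_Y ∇_X Z - ∇_[X, Y] Z`. -/
def curvature (x : M) (u v w : TangentSpace I x) : TangentSpace I x :=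
  RiemLocal.curvature (E := E) (metricInChart I x) (extChartAt I x x) u v w

/-- The Ricci curvature `Ric(u, v) = ∑ a, ⟨R(e_a, u) v, e_a⟩` at `x`, for an orthonormal basis
`e_a` of the tangent space. -/
def ricci (x : M) (u v : TangentSpace I x) : ℝ :=
  ∑ a, inner ℝ (curvature I x (stdOrthonormalBasis ℝ (TangentSpace I x) a) u v)
    (stdOrthonormalBasis ℝ (TangentSpace I x) a)

variable (M) in
/-- The Ricci curvature is non-positive. -/
def RicciNonpos : Prop :=
  ∀ (x : M) (u : TangentSpace I x), ricci I x u u ≤ 0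

/-- The (non-positive) Laplace-Beltrami operator `Δ r = ∑ i, Hess r (e_i, e_i)` on functions. -/
def laplacian (r : M → ℝ) (x : M) : ℝ :=
  ∑ i, RiemLocal.hessian (E := E) (metricInChart I x) (r ∘ (extChartAt I x).symm) (extChartAt I x x)
    (stdOrthonormalBasis ℝ (TangentSpace I x) i) (stdOrthonormalBasis ℝ (TangentSpace I x) i)

/-- `φ` is a smooth isometric immersion (it is an immersion because its derivative preserves
norms). -/
structure IsIsometricImmersion (φ : M → N) : Prop where
  contMDiff : ContMDiff I J ∞ φ
  inner_mfderiv : ∀ (x : M) (u v : TangentSpace I x),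
    inner ℝ (mfderiv I J φ x u) (mfderiv I J φ x v) = inner ℝ u v

/-- The coordinate expression, in the charts at `x` and `φ x`, of a vector field `V` along `φ`. -/
def sectionInCharts (φ : M → N) (V : (x : M) → TangentSpace J (φ x)) (x : M) (y : E) : F :=
  mfderiv J 𝓘(ℝ, F) (extChartAt J (φ x)) (φ ((extChartAt I x).symm y))
    (V ((extChartAt I x).symm y))

/-- The second fundamental form `B` of `φ` at `x`. -/
def secondForm (φ : M → N) (x : M) (u v : TangentSpace I x) : TangentSpace J (φ x) :=
  RiemLocal.secondForm (E := E) (F := F) (metricInChart I x) (metricInChart J (φ x)) (writtenInExtChartAt I J x φ)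
    (extChartAt I x x) u v

/-- The mean curvature vector field `𝐇 = (1 / m) ∑ i, B(e_i, e_i)`, where `m` is the dimension
of `M`. -/
def meanCurvature (φ : M → N) (x : M) : TangentSpace J (φ x) :=
  (Module.finrank ℝ E : ℝ)⁻¹ • ∑ i, secondForm I J φ x
    (stdOrthonormalBasis ℝ (TangentSpace I x) i) (stdOrthonormalBasis ℝ (TangentSpace I x) i)

/-- The rough Laplacian `Δ^φ V = ∑ i, (∇^φ_{e_i} ∇^φ_{e_i} V - ∇^φ_{∇_{e_i} e_i} V)` on vector
fields along `φ`. -/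
def roughLaplacian (φ : M → N) (V : (x : M) → TangentSpace J (φ x)) (x : M) :
    TangentSpace J (φ x) :=
  ∑ i, RiemLocal.covDerivAlong₂ (E := E) (F := F) (metricInChart I x) (metricInChart J (φ x))
    (writtenInExtChartAt I J x φ) (sectionInCharts I J φ V x) (extChartAt I x x)
    (stdOrthonormalBasis ℝ (TangentSpace I x) i) (stdOrthonormalBasis ℝ (TangentSpace I x) i)

/-- The curvature term `∑ i, R^N(V, dφ e_i) dφ e_i`. -/
def curvatureTrace (φ : M → N) (V : (x : M) → TangentSpace J (φ x)) (x : M) :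
    TangentSpace J (φ x) :=
  ∑ i, curvature J (φ x) (V x)
    (mfderiv I J φ x (stdOrthonormalBasis ℝ (TangentSpace I x) i))
    (mfderiv I J φ x (stdOrthonormalBasis ℝ (TangentSpace I x) i))

/-- The normal component of a vector of `T_{φ x} N`. -/
def normalPart (φ : M → N) (x : M) (w : TangentSpace J (φ x)) : TangentSpace J (φ x) :=
  (mfderiv I J φ x).rangeᗮ.starProjection w

/-- `M` is a biminimal submanifold of `N`, with parameter `lam`, through the isometric immersion
`φ`: one has `[-Δ^φ 𝐇 - ∑ i, R^N(𝐇, dφ e_i) dφ e_i]^⊥ + lam • 𝐇 = 0`. -/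
structure IsBiminimal (φ : M → N) (lam : ℝ) : Prop extends IsIsometricImmersion I J φ where
  eq_zero : ∀ x : M,
    normalPart I J φ x
      (-roughLaplacian I J φ (meanCurvature I J φ) x
        - curvatureTrace I J φ (meanCurvature I J φ) x)
      + lam • meanCurvature I J φ x = 0

end Riem

end

section

set_option maxSynthPendingDepth 3
set_option linter.unusedSectionVars false

open Filter Topology

namespace RiemLocal

variable {E : Type*} [NormedAddCommGroup E] [NormedSpace ℝ E]
  {F : Type*} [NormedAddCommGroup F] [NormedSpace ℝ F]

/-- Near the point `y`, the field of bilinear forms `g` is a smooth Riemannian metric. -/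
def IsMetricNear (g : E → E →L[ℝ] E →L[ℝ] ℝ) (y : E) : Prop :=
  ∀ᶠ z in 𝓝 y, ContDiffAt ℝ ∞ g z ∧ (∀ u v, g z u v = g z v u) ∧ ∀ u ≠ 0, 0 < g z u u

/-- Near the point `y`, the map `f` is a smooth isometric immersion. -/
def IsIsometricNear (g : E → E →L[ℝ] E →L[ℝ] ℝ) (G : F → F →L[ℝ] F →L[ℝ] ℝ) (f : E → F)
    (y : E) : Prop :=
  ∀ᶠ z in 𝓝 y, ContDiffAt ℝ ∞ f z ∧
    ∀ u v, G (f z) (fderiv ℝ f z u) (fderiv ℝ f z v) = g z u v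

/-- Near the point `y`, the map `V` is smooth. -/
def IsSmoothNear (V : E → F) (y : E) : Prop :=
  ∀ᶠ z in 𝓝 y, ContDiffAt ℝ ∞ V z

section

variable {g : E → E →L[ℝ] E →L[ℝ] ℝ} {G : F → F →L[ℝ] F →L[ℝ] ℝ} {f : E → F} {y : E}

theorem IsMetricNear.eventually (h : IsMetricNear g y) : ∀ᶠ z in 𝓝 y, IsMetricNear g z :=
  eventually_eventually_nhds.2 h

theorem IsMetricNear.contDiffAt (h : IsMetricNear g y) : ContDiffAt ℝ ∞ g y :=
  h.self_of_nhds.1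

theorem IsMetricNear.symm (h : IsMetricNear g y) (u v : E) : g y u v = g y v u :=
  h.self_of_nhds.2.1 u v

theorem IsMetricNear.pos (h : IsMetricNear g y) {u : E} (hu : u ≠ 0) : 0 < g y u u :=
  h.self_of_nhds.2.2 u hu

theorem IsIsometricNear.eventually (h : IsIsometricNear g G f y) :
    ∀ᶠ z in 𝓝 y, IsIsometricNear g G f z :=
  eventually_eventually_nhds.2 h

theorem IsIsometricNear.contDiffAt (h : IsIsometricNear g G f y) : ContDiffAt ℝ ∞ f y :=
  h.self_of_nhds.1

theorem IsIsometricNear.isometry (h : IsIsometricNear g G f y) (u v : E) :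
    G (f y) (fderiv ℝ f y u) (fderiv ℝ f y v) = g y u v :=
  h.self_of_nhds.2 u v

theorem IsIsometricNear.isSmoothNear (h : IsIsometricNear g G f y) : IsSmoothNear f y :=
  Filter.Eventually.mono h fun _ hz ↦ hz.1

theorem IsSmoothNear.eventually {V : E → F} (h : IsSmoothNear V y) :
    ∀ᶠ z in 𝓝 y, IsSmoothNear V z :=
  eventually_eventually_nhds.2 h

theorem IsSmoothNear.contDiffAt {V : E → F} (h : IsSmoothNear V y) : ContDiffAt ℝ ∞ V y :=
  h.self_of_nhds

theorem IsSmoothNear.congr {V W : E → F} (h : IsSmoothNear V y) (hVW : W =ᶠ[𝓝 y] V) :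
    IsSmoothNear W y := by
  filter_upwards [h, hVW.eventuallyEq_nhds] with z hz hz'
  exact hz.congr_of_eventuallyEq hz'

/-- A nondegenerate bilinear form is determined by its values. -/
theorem IsMetricNear.eq_of_forall (h : IsMetricNear g y) {a b : E}
    (hab : ∀ w, g y a w = g y b w) : a = b := by
  by_contra hne
  have h1 := h.pos (sub_ne_zero.2 hne)
  simp [hab] at h1

theorem IsMetricNear.differentiableAt (h : IsMetricNear g y) : DifferentiableAt ℝ g y :=
  h.contDiffAt.differentiableAt (by simp)

theorem IsSmoothNear.differentiableAt {V : E → F} (h : IsSmoothNear V y) :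
    DifferentiableAt ℝ V y :=
  h.contDiffAt.differentiableAt (by simp)

theorem _root_.ContDiffAt.fderiv_infty {V : E → F} (h : ContDiffAt ℝ ∞ V y) :
    ContDiffAt ℝ ∞ (fderiv ℝ V) y :=
  h.fderiv_right (by simp)

theorem IsSmoothNear.fderiv {V : E → F} (h : IsSmoothNear V y) :
    IsSmoothNear (fderiv ℝ V) y :=
  h.mono fun _ hz ↦ hz.fderiv_infty

theorem fderiv_fderiv_apply {V : E → F} (h : ContDiffAt ℝ ∞ V y) (u v : E) :
    fderiv ℝ (fun z ↦ fderiv ℝ V z v) y u = fderiv ℝ (fderiv ℝ V) y u v := by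
  have := h.fderiv_infty.differentiableAt (by simp)
  rw [fderiv_clm_apply this (differentiableAt_const v)]
  simp

theorem fderiv_fderiv_symm {V : E → F} (h : ContDiffAt ℝ ∞ V y) (u v : E) :
    fderiv ℝ (fderiv ℝ V) y u v = fderiv ℝ (fderiv ℝ V) y v u :=
  (h.isSymmSndFDerivAt (by simpa using WithTop.coe_le_coe.2 (le_top : (2 : ℕ∞) ≤ ⊤))).eq u v

theorem fderiv_bilin_apply {A : E → F →L[ℝ] F →L[ℝ] ℝ} {V W : E → F}
    (hA : DifferentiableAt ℝ A y) (hV : DifferentiableAt ℝ V y) (hW : DifferentiableAt ℝ W y)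
    (u : E) :
    fderiv ℝ (fun z ↦ A z (V z) (W z)) y u
      = fderiv ℝ A y u (V y) (W y) + A y (fderiv ℝ V y u) (W y) + A y (V y) (fderiv ℝ W y u) := by
  rw [fderiv_clm_apply (hA.clm_apply hV) hW, fderiv_clm_apply hA hV]
  simp
  ring

theorem IsMetricNear.fderiv_symm (h : IsMetricNear g y) (u v w : E) :
    fderiv ℝ g y u v w = fderiv ℝ g y u w v := by
  have key : ∀ a b : E, fderiv ℝ (fun z ↦ g z a b) y u = fderiv ℝ g y u a b := fun a b ↦ by
    rw [fderiv_bilin_apply h.differentiableAt (differentiableAt_const a)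
      (differentiableAt_const b)]
    simp
  rw [← key, ← key]
  refine DFunLike.congr_fun (Filter.EventuallyEq.fderiv_eq ?_) u
  filter_upwards [h.eventually] with z hz using hz.symm v w

end

section

variable [FiniteDimensional ℝ E] [FiniteDimensional ℝ F]
  {g : E → E →L[ℝ] E →L[ℝ] ℝ} {G : F → F →L[ℝ] F →L[ℝ] ℝ} {f : E → F} {y : E}

theorem IsMetricNear.isInvertible (h : IsMetricNear g y) : (g y).IsInvertible := by
  have hinj : Function.Injective (g y : E →ₗ[ℝ] (E →L[ℝ] ℝ)) := fun a b hab ↦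
    h.eq_of_forall fun w ↦ congrArg (· w) hab
  have hdim : Module.finrank ℝ E = Module.finrank ℝ (E →L[ℝ] ℝ) := by
    rw [← Subspace.dual_finrank_eq]
    exact LinearEquiv.finrank_eq LinearMap.toContinuousLinearMap
  refine ⟨(LinearMap.linearEquivOfInjective _ hinj hdim).toContinuousLinearEquiv, ?_⟩
  ext u v
  rfl

theorem IsMetricNear.apply_inverse (h : IsMetricNear g y) (ℓ : E →L[ℝ] ℝ) (w : E) :
    g y ((g y).inverse ℓ) w = ℓ w := by
  obtain ⟨e, he⟩ := h.isInvertible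
  rw [← he]
  simp

theorem IsMetricNear.christoffel_apply (h : IsMetricNear g y) (u v w : E) :
    g y (christoffel g y u v) w
      = (1 / 2 : ℝ) * (fderiv ℝ g y u v w + fderiv ℝ g y v u w - fderiv ℝ g y w u v) := by
  rw [christoffel, h.apply_inverse]
  simp

theorem IsMetricNear.fderiv_apply (h : IsMetricNear g y) (u v w : E) :
    fderiv ℝ g y u v w = g y (christoffel g y u v) w + g y v (christoffel g y u w) := by
  rw [h.symm v, h.christoffel_apply, h.christoffel_apply, h.fderiv_symm u w v]
  ring

theorem christoffel_add_left (u u' v : E) :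
    christoffel g y (u + u') v = christoffel g y u v + christoffel g y u' v := by
  rw [christoffel, christoffel, christoffel, ← map_add]
  congr 1
  ext w
  simp
  ring

theorem christoffel_add_right (u v v' : E) :
    christoffel g y u (v + v') = christoffel g y u v + christoffel g y u v' := by
  rw [christoffel, christoffel, christoffel, ← map_add]
  congr 1
  ext w
  simp
  ring

theorem christoffel_smul_left (c : ℝ) (u v : E) :
    christoffel g y (c • u) v = c • christoffel g y u v := by
  rw [christoffel, christoffel, ← map_smul]
  congr 1
  ext w
  simp
  ring

theorem christoffel_smul_right (c : ℝ) (u v : E) :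
    christoffel g y u (c • v) = c • christoffel g y u v := by
  rw [christoffel, christoffel, ← map_smul]
  congr 1
  ext w
  simp
  ring

theorem IsMetricNear.contDiffAt_inverse {X : Type*} [NormedAddCommGroup X] [NormedSpace ℝ X]
    {c : X → E} {ℓ : X → E →L[ℝ] ℝ} {x : X} (h : IsMetricNear g (c x))
    (hc : ContDiffAt ℝ ∞ c x) (hℓ : ContDiffAt ℝ ∞ ℓ x) :
    ContDiffAt ℝ ∞ (fun z ↦ (g (c z)).inverse (ℓ z)) x := by
  have := FiniteDimensional.complete ℝ E
  have h1 : ContDiffAt ℝ ∞ (fun z ↦ g (c z)) x := h.contDiffAt.comp x hc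
  have h2 := (h.isInvertible.contDiffAt_map_inverse (n := ∞)).comp x h1
  exact h2.clm_apply hℓ

theorem contDiffAt_clm_of_forall {X : Type*} [NormedAddCommGroup X] [NormedSpace ℝ X]
    {ℓ : X → E →L[ℝ] F} {x : X} (h : ∀ w, ContDiffAt ℝ ∞ (fun z ↦ ℓ z w) x) :
    ContDiffAt ℝ ∞ ℓ x := by
  refine contDiffAt_infty.2 fun n ↦ ?_
  have h1 : ∀ w, ∀ᶠ z in 𝓝 x, ContDiffAt ℝ n (fun z ↦ ℓ z w) z := fun w ↦
    ((h w).of_le (by exact_mod_cast le_top)).eventually (by simp)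
  let b := Module.finBasis ℝ E
  have h2 : ∀ᶠ z in 𝓝 x, ∀ i, ContDiffAt ℝ n (fun z ↦ ℓ z (b i)) z :=
    eventually_all.2 fun i ↦ h1 _
  have h3 : ContDiffOn ℝ n ℓ {z | ∀ i, ContDiffAt ℝ n (fun z ↦ ℓ z (b i)) z} := by
    refine contDiffOn_clm_apply.2 fun w z hz ↦ ?_
    have : (fun x ↦ ℓ x w) = fun x ↦ ∑ i, b.repr w i • ℓ x (b i) := by
      funext x
      simp_rw [← map_smul, ← map_sum, b.sum_repr w]
    rw [this]
    exact (ContDiffAt.sum fun i _ ↦ contDiffAt_const.smul (hz i)).contDiffWithinAt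
  exact h3.contDiffAt h2

theorem IsMetricNear.contDiffAt_christoffel {X : Type*} [NormedAddCommGroup X] [NormedSpace ℝ X]
    {c a b : X → E} {x : X} (h : IsMetricNear g (c x)) (hc : ContDiffAt ℝ ∞ c x)
    (ha : ContDiffAt ℝ ∞ a x) (hb : ContDiffAt ℝ ∞ b x) :
    ContDiffAt ℝ ∞ (fun z ↦ christoffel g (c z) (a z) (b z)) x := by
  refine h.contDiffAt_inverse hc (contDiffAt_clm_of_forall fun w ↦ ?_)
  have hg : ContDiffAt ℝ ∞ (fun z ↦ fderiv ℝ g (c z)) x := h.contDiffAt.fderiv_infty.comp x hc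
  simp
  exact contDiffAt_const.mul (((((hg.clm_apply ha).clm_apply hb).clm_apply contDiffAt_const).add
    (((hg.clm_apply hb).clm_apply ha).clm_apply contDiffAt_const)).sub
    (((hg.clm_apply contDiffAt_const).clm_apply ha).clm_apply hb))

theorem IsMetricNear.contDiffAt_covDerivAlong {V : E → F} (hG : IsMetricNear G (f y))
    (hf : ContDiffAt ℝ ∞ f y) (hV : ContDiffAt ℝ ∞ V y) {u : E → E} (hu : ContDiffAt ℝ ∞ u y) :
    ContDiffAt ℝ ∞ (fun z ↦ covDerivAlong G f V z (u z)) y :=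
  (hV.fderiv_infty.clm_apply hu).add
    (hG.contDiffAt_christoffel hf (hf.fderiv_infty.clm_apply hu) hV)

/-- The pulled back connection is compatible with the metric. -/
theorem fderiv_metric_along {V W : E → F} (hG : IsMetricNear G (f y))
    (hf : DifferentiableAt ℝ f y) (hV : DifferentiableAt ℝ V y) (hW : DifferentiableAt ℝ W y)
    (u : E) :
    fderiv ℝ (fun z ↦ G (f z) (V z) (W z)) y u
      = G (f y) (covDerivAlong G f V y u) (W y) + G (f y) (V y) (covDerivAlong G f W y u) := by
  have hGf : DifferentiableAt ℝ (fun z ↦ G (f z)) y := hG.differentiableAt.comp y hf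
  rw [fderiv_bilin_apply hGf hV hW]
  have : fderiv ℝ (fun z ↦ G (f z)) y u = fderiv ℝ G (f y) (fderiv ℝ f y u) :=
    DFunLike.congr_fun (fderiv_comp y hG.differentiableAt hf) u
  rw [this, hG.fderiv_apply, covDerivAlong, covDerivAlong]
  simp only [map_add, _root_.add_apply]
  ring

/-- The Hessian of `|V|²`. -/
theorem hessian_metric_along {V : E → F} (hG : IsMetricNear G (f y))
    (hf : IsSmoothNear f y) (hV : IsSmoothNear V y) (u : E) :
    hessian g (fun z ↦ G (f z) (V z) (V z)) y u u
      = 2 * G (f y) (covDerivAlong G f V y u) (covDerivAlong G f V y u)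
        + 2 * G (f y) (covDerivAlong₂ g G f V y u u) (V y) := by
  have h1 : (fun z ↦ fderiv ℝ (fun z ↦ G (f z) (V z) (V z)) z u)
      =ᶠ[𝓝 y] fun z ↦ 2 * G (f z) (covDerivAlong G f V z u) (V z) := by
    filter_upwards [hf.contDiffAt.continuousAt.eventually hG.eventually, hf.eventually,
      hV.eventually] with z hz1 hz2 hz3
    rw [fderiv_metric_along hz1 hz2.differentiableAt hz3.differentiableAt hz3.differentiableAt,
      hz1.symm (V z)]
    ring
  have h2 : ContDiffAt ℝ ∞ (fun z ↦ covDerivAlong G f V z u) y :=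
    hG.contDiffAt_covDerivAlong hf.contDiffAt hV.contDiffAt contDiffAt_const
  have h3 : ContDiffAt ℝ ∞ (fun z ↦ G (f z) (covDerivAlong G f V z u) (V z)) y :=
    ((hG.contDiffAt.comp y hf.contDiffAt).clm_apply h2).clm_apply hV.contDiffAt
  rw [hessian, h1.fderiv_eq, fderiv_const_mul (h3.differentiableAt (by simp)),
    _root_.smul_apply,
    fderiv_metric_along hG hf.differentiableAt (h2.differentiableAt (by simp))
      hV.differentiableAt,
    fderiv_metric_along hG hf.differentiableAt hV.differentiableAt hV.differentiableAt,
    hG.symm (V y), covDerivAlong₂]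
  simp only [map_sub, _root_.sub_apply, smul_eq_mul]
  ring

end

end RiemLocal

namespace RiemLocal

variable {E : Type*} [NormedAddCommGroup E] [NormedSpace ℝ E] [FiniteDimensional ℝ E]
  {F : Type*} [NormedAddCommGroup F] [NormedSpace ℝ F] [FiniteDimensional ℝ F]
  {g g₀ : E → E →L[ℝ] E →L[ℝ] ℝ} {G G₀ : F → F →L[ℝ] F →L[ℝ] ℝ} {f f₀ : E → F} {y : E}

theorem secondForm_eq (hf : ContDiffAt ℝ ∞ f y) (u v : E) :
    secondForm g G f y u v = fderiv ℝ (fderiv ℝ f) y u v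
      + christoffel G (f y) (fderiv ℝ f y u) (fderiv ℝ f y v)
      - fderiv ℝ f y (christoffel g y u v) := by
  rw [secondForm, covDerivAlong, fderiv_fderiv_apply hf]

theorem secondForm_add_left (hf : ContDiffAt ℝ ∞ f y) (u u' v : E) :
    secondForm g G f y (u + u') v = secondForm g G f y u v + secondForm g G f y u' v := by
  simp only [secondForm_eq hf, map_add, christoffel_add_left, _root_.add_apply]
  abel

theorem secondForm_add_right (hf : ContDiffAt ℝ ∞ f y) (u v v' : E) :
    secondForm g G f y u (v + v') = secondForm g G f y u v + secondForm g G f y u v' := by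
  simp only [secondForm_eq hf, map_add, christoffel_add_right]
  abel

theorem secondForm_smul_left (hf : ContDiffAt ℝ ∞ f y) (c : ℝ) (u v : E) :
    secondForm g G f y (c • u) v = c • secondForm g G f y u v := by
  simp only [secondForm_eq hf, map_smul, christoffel_smul_left, _root_.smul_apply, smul_add,
    smul_sub]

theorem secondForm_smul_right (hf : ContDiffAt ℝ ∞ f y) (c : ℝ) (u v : E) :
    secondForm g G f y u (c • v) = c • secondForm g G f y u v := by
  simp only [secondForm_eq hf, map_smul, christoffel_smul_right, smul_add, smul_sub]

/-- The second fundamental form is normal. -/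
theorem secondForm_normal (hg : IsMetricNear g y) (hG : IsMetricNear G (f y))
    (hf : IsIsometricNear g G f y) (u v w : E) :
    G (f y) (secondForm g G f y u v) (fderiv ℝ f y w) = 0 := by
  have hGf : DifferentiableAt ℝ (fun z ↦ G (f z)) y :=
    hG.differentiableAt.comp y hf.isSmoothNear.differentiableAt
  have hG' : ∀ u, fderiv ℝ (fun z ↦ G (f z)) y u = fderiv ℝ G (f y) (fderiv ℝ f y u) := fun u ↦
    DFunLike.congr_fun (fderiv_comp y hG.differentiableAt hf.isSmoothNear.differentiableAt) u
  have hf' : ∀ v, DifferentiableAt ℝ (fun z ↦ fderiv ℝ f z v) y := fun v ↦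
    (hf.contDiffAt.fderiv_infty.clm_apply contDiffAt_const).differentiableAt (by simp)
  have key : ∀ u v w, fderiv ℝ g y u v w
      = fderiv ℝ G (f y) (fderiv ℝ f y u) (fderiv ℝ f y v) (fderiv ℝ f y w)
        + G (f y) (fderiv ℝ (fderiv ℝ f) y u v) (fderiv ℝ f y w)
        + G (f y) (fderiv ℝ f y v) (fderiv ℝ (fderiv ℝ f) y u w) := by
    intro u v w
    have h1 : fderiv ℝ (fun z ↦ g z v w) y u = fderiv ℝ g y u v w := by
      rw [fderiv_bilin_apply hg.differentiableAt (differentiableAt_const v)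
        (differentiableAt_const w)]
      simp
    have h2 : (fun z ↦ g z v w) =ᶠ[𝓝 y] fun z ↦ G (f z) (fderiv ℝ f z v) (fderiv ℝ f z w) := by
      filter_upwards [hf.eventually] with z hz using (hz.isometry v w).symm
    rw [← h1, h2.fderiv_eq, fderiv_bilin_apply hGf (hf' v) (hf' w), hG',
      fderiv_fderiv_apply hf.contDiffAt, fderiv_fderiv_apply hf.contDiffAt]
  rw [secondForm_eq hf.contDiffAt]
  simp only [map_add, map_sub, _root_.add_apply, _root_.sub_apply]
  rw [hf.isometry, hg.christoffel_apply, hG.christoffel_apply, key, key, key,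
    fderiv_fderiv_symm hf.contDiffAt w u, fderiv_fderiv_symm hf.contDiffAt w v,
    fderiv_fderiv_symm hf.contDiffAt v u, hG.symm (fderiv ℝ f y v),
    hG.symm (fderiv ℝ f y u)]
  ring

/-- The second fundamental form of a local isometry vanishes. -/
theorem secondForm_eq_zero (hg : IsMetricNear g y) (hG : IsMetricNear G (f y))
    (hf : IsIsometricNear g G f y) (hs : Function.Surjective (fderiv ℝ f y)) (u v : E) :
    secondForm g G f y u v = 0 := by
  refine hG.eq_of_forall fun w ↦ ?_
  obtain ⟨w, rfl⟩ := hs w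
  simp [secondForm_normal hg hG hf]

theorem fderiv_fderiv_comp {X : Type*} [NormedAddCommGroup X] [NormedSpace ℝ X] {s : F → X}
    (hs : IsSmoothNear s (f y)) (hf : IsSmoothNear f y) (u v : E) :
    fderiv ℝ (fderiv ℝ (s ∘ f)) y u v
      = fderiv ℝ (fderiv ℝ s) (f y) (fderiv ℝ f y u) (fderiv ℝ f y v)
        + fderiv ℝ s (f y) (fderiv ℝ (fderiv ℝ f) y u v) := by
  have h1 : (fun z ↦ fderiv ℝ (s ∘ f) z v) =ᶠ[𝓝 y] fun z ↦ fderiv ℝ s (f z) (fderiv ℝ f z v) := by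
    filter_upwards [hf.contDiffAt.continuousAt.eventually hs.eventually, hf.eventually]
      with z hz1 hz2
    rw [fderiv_comp z hz1.differentiableAt hz2.differentiableAt]
    rfl
  have hs' : DifferentiableAt ℝ (fderiv ℝ s) (f y) :=
    hs.contDiffAt.fderiv_infty.differentiableAt (by simp)
  have h2 : fderiv ℝ (fun z ↦ fderiv ℝ s (f z)) y u
      = fderiv ℝ (fderiv ℝ s) (f y) (fderiv ℝ f y u) :=
    DFunLike.congr_fun (fderiv_comp y hs' hf.differentiableAt) u
  have hs'' : DifferentiableAt ℝ (fun z ↦ fderiv ℝ s (f z)) y := hs'.comp y hf.differentiableAt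
  rw [← fderiv_fderiv_apply (hs.contDiffAt.comp y hf.contDiffAt), h1.fderiv_eq,
    fderiv_clm_apply hs''
      ((hf.contDiffAt.fderiv_infty.clm_apply contDiffAt_const).differentiableAt (by simp))]
  simp only [_root_.add_apply, ContinuousLinearMap.comp_apply, ContinuousLinearMap.flip_apply]
  rw [h2, fderiv_fderiv_apply hf.contDiffAt, add_comm]

/-- The second fundamental form does not depend on the coordinates: `τ` and `σ` are changes of
coordinates of the source and of the target. -/
theorem secondForm_coordChange {τ : E → E} {σ : F → F}
    (hg : IsMetricNear g y) (hg₀ : IsMetricNear g₀ (τ y))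
    (hG : IsMetricNear G (f y)) (hG₀ : IsMetricNear G₀ (σ (f y)))
    (hτ : IsIsometricNear g g₀ τ y) (hσ : IsIsometricNear G G₀ σ (f y))
    (hτs : Function.Surjective (fderiv ℝ τ y)) (hσs : Function.Surjective (fderiv ℝ σ (f y)))
    (hf : IsSmoothNear f y) (hf₀ : IsSmoothNear f₀ (τ y)) (h : f₀ ∘ τ =ᶠ[𝓝 y] σ ∘ f) (u v : E) :
    fderiv ℝ σ (f y) (secondForm g G f y u v)
      = secondForm g₀ G₀ f₀ (τ y) (fderiv ℝ τ y u) (fderiv ℝ τ y v) := by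
  have e1 := secondForm_eq_zero hg hg₀ hτ hτs u v
  have e2 := secondForm_eq_zero hG hG₀ hσ hσs (fderiv ℝ f y u) (fderiv ℝ f y v)
  rw [secondForm_eq hτ.contDiffAt] at e1
  rw [secondForm_eq hσ.contDiffAt] at e2
  have d1 : ∀ u, fderiv ℝ f₀ (τ y) (fderiv ℝ τ y u) = fderiv ℝ σ (f y) (fderiv ℝ f y u) := by
    intro u
    have : fderiv ℝ (f₀ ∘ τ) y u = fderiv ℝ (σ ∘ f) y u := by rw [h.fderiv_eq]
    rwa [fderiv_comp y hf₀.differentiableAt hτ.isSmoothNear.differentiableAt,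
      fderiv_comp y hσ.isSmoothNear.differentiableAt hf.differentiableAt] at this
  have d2 : fderiv ℝ (fderiv ℝ (f₀ ∘ τ)) y u v = fderiv ℝ (fderiv ℝ (σ ∘ f)) y u v := by
    rw [h.fderiv.fderiv_eq]
  rw [fderiv_fderiv_comp hf₀ hτ.isSmoothNear, fderiv_fderiv_comp hσ.isSmoothNear hf] at d2
  have e0 : f₀ (τ y) = σ (f y) := h.self_of_nhds
  rw [secondForm_eq hf.contDiffAt, secondForm_eq hf₀.contDiffAt, e0, d1, d1]
  have e3 := congrArg (fderiv ℝ f₀ (τ y)) (sub_eq_zero.1 e1)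
  rw [map_add, d1] at e3
  rw [map_sub, map_add, ← sub_eq_zero.1 e2, ← e3]
  rw [← sub_eq_zero] at d2 ⊢
  rw [← neg_eq_zero, ← d2]
  abel

/-- The frame `e` is orthonormal for the metric `g` at `y`, and spans. -/
structure IsOrthonormalFrame {ι : Type*} [Fintype ι] (g : E → E →L[ℝ] E →L[ℝ] ℝ) (y : E)
    (e : ι → E) : Prop where
  sum_eq : ∀ x, ∑ i, g y (e i) x • e i = x
  self_eq : ∀ i, g y (e i) (e i) = 1

/-- The mean curvature vector at `y`, computed with an arbitrary basis. -/
noncomputable def meanCurvature (g : E → E →L[ℝ] E →L[ℝ] ℝ) (G : F → F →L[ℝ] F →L[ℝ] ℝ)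
    (f : E → F) (y : E) : F :=
  (Module.finrank ℝ E : ℝ)⁻¹ • ∑ j, secondForm g G f y
    ((g y).inverse (LinearMap.toContinuousLinearMap ((Module.finBasis ℝ E).coord j)))
    (Module.finBasis ℝ E j)

theorem secondForm_sum_left (hf : ContDiffAt ℝ ∞ f y) {ι : Type*} (s : Finset ι) (c : ι → ℝ)
    (u : ι → E) (v : E) :
    secondForm g G f y (∑ i ∈ s, c i • u i) v = ∑ i ∈ s, c i • secondForm g G f y (u i) v :=
  map_sum (⟨⟨fun u ↦ secondForm g G f y u v, fun _ _ ↦ secondForm_add_left hf _ _ _⟩,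
    fun _ _ ↦ secondForm_smul_left hf _ _ _⟩ : E →ₗ[ℝ] F) (fun i ↦ c i • u i) s |>.trans
    (Finset.sum_congr rfl fun _ _ ↦ secondForm_smul_left hf _ _ _)

theorem secondForm_sum_right (hf : ContDiffAt ℝ ∞ f y) {ι : Type*} (s : Finset ι) (c : ι → ℝ)
    (u : E) (v : ι → E) :
    secondForm g G f y u (∑ i ∈ s, c i • v i) = ∑ i ∈ s, c i • secondForm g G f y u (v i) :=
  map_sum (⟨⟨fun v ↦ secondForm g G f y u v, fun _ _ ↦ secondForm_add_right hf _ _ _⟩,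
    fun _ _ ↦ secondForm_smul_right hf _ _ _⟩ : E →ₗ[ℝ] F) (fun i ↦ c i • v i) s |>.trans
    (Finset.sum_congr rfl fun _ _ ↦ secondForm_smul_right hf _ _ _)

theorem meanCurvature_eq {ι : Type*} [Fintype ι] {e : ι → E} (hg : IsMetricNear g y)
    (hf : ContDiffAt ℝ ∞ f y) (he : IsOrthonormalFrame g y e) :
    meanCurvature g G f y
      = (Module.finrank ℝ E : ℝ)⁻¹ • ∑ i, secondForm g G f y (e i) (e i) := by
  let b := Module.finBasis ℝ E
  have h1 : ∀ ℓ : E →L[ℝ] ℝ, (g y).inverse ℓ = ∑ i, ℓ (e i) • e i := by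
    intro ℓ
    rw [← he.sum_eq ((g y).inverse ℓ)]
    refine Finset.sum_congr rfl fun i _ ↦ ?_
    rw [hg.symm, hg.apply_inverse]
  rw [meanCurvature]
  congr 1
  simp only [h1, secondForm_sum_left hf]
  rw [Finset.sum_comm]
  refine Finset.sum_congr rfl fun i _ ↦ ?_
  rw [← secondForm_sum_right hf]
  congr 1
  exact b.sum_repr (e i)

theorem isSmoothNear_meanCurvature (hg : IsMetricNear g y) (hG : IsMetricNear G (f y))
    (hf : IsSmoothNear f y) : IsSmoothNear (meanCurvature g G f) y := by
  filter_upwards [hg.eventually, hf.contDiffAt.continuousAt.eventually hG.eventually,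
    hf.eventually] with z hg hG hf
  refine contDiffAt_const.smul (ContDiffAt.sum fun j _ ↦ ?_)
  have h1 : ContDiffAt ℝ ∞ (fun x ↦ (g x).inverse (LinearMap.toContinuousLinearMap
      ((Module.finBasis ℝ E).coord j))) z :=
    hg.contDiffAt_inverse contDiffAt_id contDiffAt_const
  refine ContDiffAt.congr_of_eventuallyEq ?_
    (hf.eventually.mono fun x hx ↦ secondForm_eq hx.contDiffAt _ _)
  have h2 := hf.contDiffAt.fderiv_infty
  exact (((h2.fderiv_infty.clm_apply h1).clm_apply contDiffAt_const).add
    (hG.contDiffAt_christoffel hf.contDiffAt (h2.clm_apply h1)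
      (h2.clm_apply contDiffAt_const))).sub
    (h2.clm_apply (hg.contDiffAt_christoffel contDiffAt_id h1 contDiffAt_const))

theorem meanCurvature_normal (hg : IsMetricNear g y) (hG : IsMetricNear G (f y))
    (hf : IsIsometricNear g G f y) (w : E) :
    G (f y) (meanCurvature g G f y) (fderiv ℝ f y w) = 0 := by
  simp [meanCurvature, secondForm_normal hg hG hf]

/-- Weingarten formula. -/
theorem covDerivAlong_normal {V : E → F} (hG : IsMetricNear G (f y))
    (hf : IsIsometricNear g G f y) (hV : IsSmoothNear V y)
    (hVn : ∀ᶠ z in 𝓝 y, ∀ w, G (f z) (V z) (fderiv ℝ f z w) = 0) (u w : E) :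
    G (f y) (covDerivAlong G f V y u) (fderiv ℝ f y w)
      = - G (f y) (V y) (secondForm g G f y u w) := by
  have h1 := fderiv_metric_along hG hf.isSmoothNear.differentiableAt hV.differentiableAt
    ((hf.contDiffAt.fderiv_infty.clm_apply (contDiffAt_const (c := w))).differentiableAt (by simp))
    u
  have h2 : (fun z ↦ G (f z) (V z) (fderiv ℝ f z w)) =ᶠ[𝓝 y] fun _ ↦ 0 := by
    filter_upwards [hVn] with z hz using hz w
  rw [h2.fderiv_eq, fderiv_const_apply, _root_.zero_apply] at h1
  rw [secondForm, map_sub, hVn.self_of_nhds]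
  linarith

theorem IsMetricNear.sq_apply_le (hG : IsMetricNear g y) (a : E) {b : E} (hb : g y b b = 1) :
    g y a b ^ 2 ≤ g y a a := by
  have h : 0 ≤ g y (a - g y a b • b) (a - g y a b • b) := by
    rcases eq_or_ne (a - g y a b • b) 0 with h0 | h0
    · simp [h0]
    · exact (hG.pos h0).le
  simp only [map_sub, map_smul, _root_.sub_apply, _root_.smul_apply, smul_eq_mul, hb,
    hG.symm b a] at h
  linarith

/-- Bochner type inequality for the mean curvature vector. -/
theorem le_sum_hessian {ι : Type*} [Fintype ι] {e : ι → E} {V : E → F} (hg : IsMetricNear g y)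
    (hG : IsMetricNear G (f y)) (hf : IsIsometricNear g G f y) (he : IsOrthonormalFrame g y e)
    (hV : V =ᶠ[𝓝 y] meanCurvature g G f) (hcard : Fintype.card ι = Module.finrank ℝ E)
    (hΔ : 0 ≤ G (f y) (∑ i, covDerivAlong₂ g G f V y (e i) (e i)) (V y)) :
    2 * (Module.finrank ℝ E : ℝ) * G (f y) (V y) (V y) ^ 2
      ≤ ∑ i, hessian g (fun z ↦ G (f z) (V z) (V z)) y (e i) (e i) := by
  have hVs : IsSmoothNear V y := (isSmoothNear_meanCurvature hg hG hf.isSmoothNear).congr hV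
  have hVn : ∀ᶠ z in 𝓝 y, ∀ w, G (f z) (V z) (fderiv ℝ f z w) = 0 := by
    filter_upwards [hV, hg.eventually, hf.contDiffAt.continuousAt.eventually hG.eventually,
      hf.eventually] with z h1 h2 h3 h4 w
    rw [h1, meanCurvature_normal h2 h3 h4]
  simp only [hessian_metric_along hG hf.isSmoothNear hVs, Finset.sum_add_distrib,
    ← Finset.mul_sum]
  have h1 : ∀ i, G (f y) (V y) (secondForm g G f y (e i) (e i)) ^ 2
      ≤ G (f y) (covDerivAlong G f V y (e i)) (covDerivAlong G f V y (e i)) := fun i ↦ by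
    rw [← neg_sq, ← covDerivAlong_normal hG hf hVs hVn]
    exact hG.sq_apply_le _ (by rw [hf.isometry, he.self_eq])
  have h2 := sq_sum_le_card_mul_sum_sq (s := Finset.univ)
    (f := fun i ↦ G (f y) (V y) (secondForm g G f y (e i) (e i)))
  have h3 : ∑ i, G (f y) (covDerivAlong₂ g G f V y (e i) (e i)) (V y)
      = G (f y) (∑ i, covDerivAlong₂ g G f V y (e i) (e i)) (V y) := by
    rw [map_sum, _root_.sum_apply]
  have h4 := Finset.sum_le_sum fun i (_ : i ∈ Finset.univ) ↦ h1 i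
  rw [h3]
  set n : ℝ := (Module.finrank ℝ E : ℝ) with hn
  suffices h : n * G (f y) (V y) (V y) ^ 2
      ≤ ∑ i, G (f y) (V y) (secondForm g G f y (e i) (e i)) ^ 2 by linarith
  have hn0 : 0 ≤ n := Nat.cast_nonneg _
  rcases hn0.eq_or_lt with h0 | h0
  · rw [← h0, zero_mul]
    exact Finset.sum_nonneg fun i _ ↦ sq_nonneg _
  · have h5 : ∑ i, G (f y) (V y) (secondForm g G f y (e i) (e i))
        = n * G (f y) (V y) (V y) := by
      have h6 : n • V y = ∑ i, secondForm g G f y (e i) (e i) := by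
        rw [hV.self_of_nhds, meanCurvature_eq hg hf.contDiffAt he, smul_smul,
          mul_inv_cancel₀ h0.ne', one_smul]
      rw [← map_sum, ← h6, map_smul, smul_eq_mul]
    rw [h5, Finset.card_univ, hcard, ← hn] at h2
    refine le_of_mul_le_mul_left ?_ h0
    linarith

/-! ### Symmetries of the curvature -/

theorem curvature_antisymm (u v w : E) : curvature g y u v w = -curvature g y v u w := by
  simp only [curvature]
  abel

theorem curvature_self (u w : E) : curvature g y u u w = 0 := by
  simp only [curvature]
  abel

theorem IsMetricNear.differentiableAt_christoffel (hg : IsMetricNear g y) (u v : E) :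
    DifferentiableAt ℝ (fun z ↦ christoffel g z u v) y :=
  (hg.contDiffAt_christoffel contDiffAt_id contDiffAt_const contDiffAt_const).differentiableAt
    (by simp)

theorem IsMetricNear.curvature_add_left (hg : IsMetricNear g y) (u u' v w : E) :
    curvature g y (u + u') v w = curvature g y u v w + curvature g y u' v w := by
  simp only [curvature, christoffel_add_left, christoffel_add_right, map_add]
  rw [fderiv_fun_add (hg.differentiableAt_christoffel u w) (hg.differentiableAt_christoffel u' w)]
  simp only [_root_.add_apply]
  abel

theorem IsMetricNear.curvature_smul_left (hg : IsMetricNear g y) (c : ℝ) (u v w : E) :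
    curvature g y (c • u) v w = c • curvature g y u v w := by
  simp only [curvature, christoffel_smul_left, christoffel_smul_right, map_smul]
  rw [fderiv_fun_const_smul (hg.differentiableAt_christoffel u w)]
  simp only [_root_.smul_apply, smul_add, smul_sub]

/-- The curvature operators are skew-adjoint. -/
theorem IsMetricNear.apply_curvature (hg : IsMetricNear g y) (u v w z : E) :
    g y (curvature g y u v w) z = -g y w (curvature g y u v z) := by
  have hsm : ContDiffAt ℝ ∞ (fun x ↦ g x w z) y :=
    (hg.contDiffAt.clm_apply contDiffAt_const).clm_apply contDiffAt_const
  have key : ∀ u v, fderiv ℝ (fderiv ℝ (fun x ↦ g x w z)) y u v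
      = g y (fderiv ℝ (fun x ↦ christoffel g x v w) y u
          + christoffel g y u (christoffel g y v w)) z
        + g y (christoffel g y v w) (christoffel g y u z)
        + (g y (christoffel g y u w) (christoffel g y v z)
        + g y w (fderiv ℝ (fun x ↦ christoffel g x v z) y u
          + christoffel g y u (christoffel g y v z))) := by
    intro u v
    have h1 : (fun x ↦ fderiv ℝ (fun x ↦ g x w z) x v)
        =ᶠ[𝓝 y] fun x ↦ g x (christoffel g x v w) z + g x w (christoffel g x v z) := by
      filter_upwards [hg.eventually] with x hx
      rw [fderiv_bilin_apply hx.differentiableAt (differentiableAt_const w)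
        (differentiableAt_const z)]
      simp [hx.fderiv_apply]
    have hc := hg.differentiableAt_christoffel v
    have hd : ∀ {a b : E → E}, DifferentiableAt ℝ a y → DifferentiableAt ℝ b y →
        DifferentiableAt ℝ (fun x ↦ g x (a x) (b x)) y := fun ha hb ↦
      (hg.differentiableAt.clm_apply ha).clm_apply hb
    have hm := fun {a b : E → E} (ha : DifferentiableAt ℝ a y) (hb : DifferentiableAt ℝ b y) ↦
      fderiv_metric_along (f := fun x ↦ x) hg differentiableAt_id ha hb u
    rw [← fderiv_fderiv_apply hsm, h1.fderiv_eq, fderiv_fun_add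
      (hd (hc w) (differentiableAt_const z)) (hd (differentiableAt_const w) (hc z)),
      _root_.add_apply, hm (hc w) (differentiableAt_const z), hm (differentiableAt_const w) (hc z)]
    simp [covDerivAlong]
  have h := fderiv_fderiv_symm hsm u v
  rw [key, key] at h
  simp only [curvature, map_add, map_sub, _root_.add_apply, _root_.sub_apply] at h ⊢
  linarith

theorem IsMetricNear.curvature_pair (hg : IsMetricNear g y) (a b : E) :
    g y (curvature g y a b b) a = g y (curvature g y b a a) b := by
  rw [hg.apply_curvature, curvature_antisymm, map_neg, neg_neg, hg.symm]

end RiemLocal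

namespace RiemLocal

variable {E : Type*} [NormedAddCommGroup E] [NormedSpace ℝ E] [FiniteDimensional ℝ E]
  {F : Type*} [NormedAddCommGroup F] [NormedSpace ℝ F] [FiniteDimensional ℝ F]

theorem IsIsometricNear.injective {g : E → E →L[ℝ] E →L[ℝ] ℝ} {G : F → F →L[ℝ] F →L[ℝ] ℝ}
    {f : E → F} {y : E} (hf : IsIsometricNear g G f y) (hg : IsMetricNear g y) :
    Function.Injective (fderiv ℝ f y) := by
  refine (injective_iff_map_eq_zero _).2 fun u hu ↦ ?_
  by_contra hne
  have h1 := hg.pos hne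
  rw [← hf.isometry, hu] at h1
  simp at h1

theorem IsIsometricNear.surjective {g g₀ : E → E →L[ℝ] E →L[ℝ] ℝ}
    {τ : E → E} {y : E} (hτ : IsIsometricNear g g₀ τ y) (hg : IsMetricNear g y) :
    Function.Surjective (fderiv ℝ τ y) :=
  LinearMap.injective_iff_surjective.1
    (show Function.Injective (fderiv ℝ τ y : E →ₗ[ℝ] E) from hτ.injective hg)

theorem hessian_congr {g : E → E →L[ℝ] E →L[ℝ] ℝ} {r s : E → ℝ} {y : E} (h : r =ᶠ[𝓝 y] s)
    (u v : E) : hessian g r y u v = hessian g s y u v := by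
  have h1 : (fun z ↦ fderiv ℝ r z v) =ᶠ[𝓝 y] fun z ↦ fderiv ℝ s z v :=
    (h.fderiv (𝕜 := ℝ)).mono fun z hz ↦ by simp only [hz]
  rw [hessian, hessian, h1.fderiv_eq, h.fderiv_eq]

end RiemLocal

namespace Riem

open RiemLocal

variable {E : Type*} [NormedAddCommGroup E] [NormedSpace ℝ E] [FiniteDimensional ℝ E]
  {H : Type*} [TopologicalSpace H] {I : ModelWithCorners ℝ E H} [I.Boundaryless]
  {M : Type*} [TopologicalSpace M] [ChartedSpace H M] [IsManifold I ∞ M]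
  [Bundle.RiemannianBundle (fun x : M ↦ TangentSpace I x)]

section chart

theorem isManifold_one : IsManifold I 1 M := IsManifold.of_le (n := ∞) (by simp)

variable (I) in
/-- The derivative at `p` of the chart at `x`. -/
noncomputable def chartDeriv (x p : M) : TangentSpace I p →L[ℝ] E :=
  mfderiv I 𝓘(ℝ, E) (extChartAt I x) p

variable (I) in
/-- The derivative at `y` of the inverse of the chart at `x`. -/
noncomputable def chartSymmDeriv (x : M) (y : E) :
    E →L[ℝ] TangentSpace I ((extChartAt I x).symm y) :=
  mfderiv 𝓘(ℝ, E) I (extChartAt I x).symm y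

theorem chartDeriv_chartSymmDeriv {x : M} {y : E} (hy : y ∈ (extChartAt I x).target) (u : E) :
    chartDeriv I x ((extChartAt I x).symm y) (chartSymmDeriv I x y u) = u := by
  have := isManifold_one (I := I) (M := M)
  have h := mfderiv_extChartAt_comp_mfderivWithin_extChartAt_symm (I := I) hy
  rw [I.range_eq_univ, mfderivWithin_univ] at h
  exact DFunLike.congr_fun h u

theorem chartSymmDeriv_chartDeriv {x : M} {y : E} (hy : y ∈ (extChartAt I x).target)
    (u : TangentSpace I ((extChartAt I x).symm y)) :
    chartSymmDeriv I x y (chartDeriv I x ((extChartAt I x).symm y) u) = u := by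
  have := isManifold_one (I := I) (M := M)
  have h := mfderivWithin_extChartAt_symm_comp_mfderiv_extChartAt (I := I) hy
  rw [I.range_eq_univ, mfderivWithin_univ] at h
  exact DFunLike.congr_fun h u

theorem chartDeriv_surjective {x p : M} (hp : p ∈ (extChartAt I x).source) :
    Function.Surjective (chartDeriv I x p) := by
  intro u
  have h := chartDeriv_chartSymmDeriv ((extChartAt I x).map_source hp) u
  rw [(extChartAt I x).left_inv hp] at h
  exact ⟨_, h⟩

theorem chartDeriv_self (x : M) (u : TangentSpace I x) : chartDeriv I x x u = u := by
  have := isManifold_one (I := I) (M := M)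
  rw [chartDeriv, mfderiv_extChartAt_self]
  rfl

theorem metricInChart_apply (x : M) (y u v : E) :
    metricInChart I x y u v = inner ℝ (chartSymmDeriv I x y u) (chartSymmDeriv I x y v) :=
  rfl

theorem metricInChart_chartDeriv_of_eq {x : M} {y : E} (hy : y ∈ (extChartAt I x).target) {p : M}
    (hp : (extChartAt I x).symm y = p) (u v : TangentSpace I p) :
    metricInChart I x y (chartDeriv I x p u) (chartDeriv I x p v) = inner ℝ u v := by
  subst hp
  rw [metricInChart_apply, chartSymmDeriv_chartDeriv hy, chartSymmDeriv_chartDeriv hy]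

theorem metricInChart_chartDeriv {x p : M} (hp : p ∈ (extChartAt I x).source)
    (u v : TangentSpace I p) :
    metricInChart I x (extChartAt I x p) (chartDeriv I x p u) (chartDeriv I x p v) = inner ℝ u v :=
  metricInChart_chartDeriv_of_eq ((extChartAt I x).map_source hp)
    ((extChartAt I x).left_inv hp) u v

theorem metricInChart_self (x : M) (u v : TangentSpace I x) :
    metricInChart I x (extChartAt I x x) u v = inner ℝ u v := by
  have h := metricInChart_chartDeriv (mem_extChartAt_source (I := I) x) u v
  rwa [chartDeriv_self, chartDeriv_self] at h

theorem contMDiffAt_chartSymmDeriv {x : M} {y : E} (hy : y ∈ (extChartAt I x).target)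
    (u : E) :
    ContMDiffAt 𝓘(ℝ, E) I.tangent ∞ (fun z ↦ (⟨(extChartAt I x).symm z,
      chartSymmDeriv I x z u⟩ : TangentBundle I M)) y := by
  have hopen := isOpen_extChartAt_target (I := I) x
  have h1 : ContMDiffOn 𝓘(ℝ, E) I ∞ (extChartAt I x).symm (extChartAt I x).target :=
    contMDiffOn_extChartAt_symm x
  have h2 := h1.contMDiffOn_tangentMapWithin (m := ∞) (by simp) hopen.uniqueMDiffOn
  have h3 : ContMDiff 𝓘(ℝ, E) (𝓘(ℝ, E).tangent) ∞
      (fun z : E ↦ (⟨z, u⟩ : TangentBundle 𝓘(ℝ, E) E)) :=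
    contMDiff_vectorSpace_iff_contDiff.2 contDiff_const
  have h4 := (h2.comp (s := (extChartAt I x).target) h3.contMDiffOn fun z hz ↦ hz).contMDiffAt
    (hopen.mem_nhds hy)
  refine h4.congr_of_eventuallyEq ?_
  filter_upwards [hopen.mem_nhds hy] with z hz
  simp only [Function.comp_def, tangentMapWithin, mfderivWithin_of_isOpen hopen hz]
  rfl

theorem isMetricNear_metricInChart [IsContMDiffRiemannianBundle I ∞ E
    (fun x : M ↦ TangentSpace I x)] {x : M} {y : E} (hy : y ∈ (extChartAt I x).target) :
    IsMetricNear (metricInChart I x) y := by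
  filter_upwards [(isOpen_extChartAt_target (I := I) x).mem_nhds hy] with z hz
  refine ⟨?_, fun u v ↦ ?_, fun u hu ↦ ?_⟩
  · refine contDiffAt_clm_of_forall fun u ↦ contDiffAt_clm_of_forall fun v ↦ ?_
    have h : ContMDiffAt 𝓘(ℝ, E) 𝓘(ℝ, ℝ) ∞
        (fun z ↦ inner ℝ (chartSymmDeriv I x z u) (chartSymmDeriv I x z v)) z :=
      ContMDiffAt.inner_bundle (F := E) (E := fun x : M ↦ TangentSpace I x) (IB := I)
        (b := (extChartAt I x).symm) (contMDiffAt_chartSymmDeriv hz u)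
        (contMDiffAt_chartSymmDeriv hz v)
    exact h.contDiffAt
  · rw [metricInChart_apply, metricInChart_apply, real_inner_comm]
  · rw [metricInChart_apply, real_inner_self_eq_norm_sq]
    refine pow_pos (norm_pos_iff.2 fun h ↦ hu ?_) 2
    rw [← chartDeriv_chartSymmDeriv hz u, h, map_zero]

end chart

section immersion

variable {F : Type*} [NormedAddCommGroup F] [NormedSpace ℝ F] [FiniteDimensional ℝ F]
  {H' : Type*} [TopologicalSpace H'] {J : ModelWithCorners ℝ F H'} [J.Boundaryless]
  {N : Type*} [TopologicalSpace N] [ChartedSpace H' N] [IsManifold J ∞ N]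
  [Bundle.RiemannianBundle (fun p : N ↦ TangentSpace J p)]
  {φ : M → N}

variable (I J) in
/-- The coordinate expression of `φ` in the charts at `a` and `b`. -/
noncomputable def coordMap (φ : M → N) (a : M) (b : N) : E → F :=
  extChartAt J b ∘ φ ∘ (extChartAt I a).symm

theorem isIsometricImmersion_id : IsIsometricImmersion I I (id : M → M) where
  contMDiff := contMDiff_id
  inner_mfderiv x u v := by
    rw [mfderiv_id]
    rfl

theorem contMDiffAt_coordMap (hφ : IsIsometricImmersion I J φ) {a : M} {b : N} {y : E}
    (hy : y ∈ (extChartAt I a).target)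
    (hb : φ ((extChartAt I a).symm y) ∈ (extChartAt J b).source) :
    ContDiffAt ℝ ∞ (coordMap I J φ a b) y := by
  have h1 : ContMDiffAt 𝓘(ℝ, E) I ∞ (extChartAt I a).symm y :=
    (contMDiffOn_extChartAt_symm a).contMDiffAt ((isOpen_extChartAt_target a).mem_nhds hy)
  have h2 : ContMDiffAt J 𝓘(ℝ, F) ∞ (extChartAt J b) (φ ((extChartAt I a).symm y)) :=
    contMDiffAt_extChartAt' (by rwa [extChartAt_source] at hb)
  exact (h2.comp y ((hφ.contMDiff _).comp y h1)).contDiffAt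

theorem fderiv_coordMap (hφ : IsIsometricImmersion I J φ) {a : M} {b : N} {y : E}
    (hy : y ∈ (extChartAt I a).target)
    (hb : φ ((extChartAt I a).symm y) ∈ (extChartAt J b).source) (u : E) :
    fderiv ℝ (coordMap I J φ a b) y u = chartDeriv J b (φ ((extChartAt I a).symm y))
      (mfderiv I J φ ((extChartAt I a).symm y) (chartSymmDeriv I a y u)) := by
  have h1 : MDifferentiableAt 𝓘(ℝ, E) I (extChartAt I a).symm y :=
    ((contMDiffOn_extChartAt_symm (n := ∞) a).contMDiffAt
      ((isOpen_extChartAt_target a).mem_nhds hy)).mdifferentiableAt (by simp)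
  have h2 : MDifferentiableAt J 𝓘(ℝ, F) (extChartAt J b) (φ ((extChartAt I a).symm y)) :=
    (contMDiffAt_extChartAt' (n := ∞) (by rwa [extChartAt_source] at hb)).mdifferentiableAt
      (by simp)
  have h3 : MDifferentiableAt I J φ ((extChartAt I a).symm y) :=
    (hφ.contMDiff _).mdifferentiableAt (by simp)
  rw [← mfderiv_eq_fderiv, coordMap, mfderiv_comp y h2 (h3.comp y h1), mfderiv_comp y h3 h1]
  rfl

theorem eventually_mem_source (hφ : IsIsometricImmersion I J φ) {a : M} {b : N} {y : E}
    (hy : y ∈ (extChartAt I a).target)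
    (hb : φ ((extChartAt I a).symm y) ∈ (extChartAt J b).source) :
    ∀ᶠ z in 𝓝 y, z ∈ (extChartAt I a).target ∧
      φ ((extChartAt I a).symm z) ∈ (extChartAt J b).source := by
  refine Filter.Eventually.and ((isOpen_extChartAt_target a).mem_nhds hy) ?_
  have h1 : ContinuousAt (fun z ↦ φ ((extChartAt I a).symm z)) y :=
    hφ.contMDiff.continuous.continuousAt.comp (continuousAt_extChartAt_symm'' hy)
  exact h1.eventually ((isOpen_extChartAt_source b).mem_nhds hb)

theorem isIsometricNear_coordMap (hφ : IsIsometricImmersion I J φ) {a : M} {b : N} {y : E}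
    (hy : y ∈ (extChartAt I a).target)
    (hb : φ ((extChartAt I a).symm y) ∈ (extChartAt J b).source) :
    IsIsometricNear (metricInChart I a) (metricInChart J b) (coordMap I J φ a b) y := by
  filter_upwards [eventually_mem_source hφ hy hb] with z ⟨hz, hzb⟩
  refine ⟨contMDiffAt_coordMap hφ hz hzb, fun u v ↦ ?_⟩
  rw [fderiv_coordMap hφ hz hzb, fderiv_coordMap hφ hz hzb]
  exact (metricInChart_chartDeriv hzb _ _).trans (hφ.inner_mfderiv _ _ _)

theorem fderiv_coordMap_id {a x : M} (ha : a ∈ (extChartAt I x).source) (u : TangentSpace I a) :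
    fderiv ℝ (coordMap I I id a x) (extChartAt I a a) u = chartDeriv I x a u := by
  have h : MDifferentiableAt I 𝓘(ℝ, E) (extChartAt I x) a :=
    (contMDiffAt_extChartAt' (n := ∞) (by rwa [extChartAt_source] at ha)).mdifferentiableAt
      (by simp)
  rw [chartDeriv, h.mfderiv, I.range_eq_univ, fderivWithin_univ]
  rfl

variable [IsContMDiffRiemannianBundle I ∞ E (fun x : M ↦ TangentSpace I x)]
  [IsContMDiffRiemannianBundle J ∞ F (fun x : N ↦ TangentSpace J x)]

/-- The second fundamental form at `p`, read in arbitrary charts. -/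
theorem chartDeriv_secondForm (hφ : IsIsometricImmersion I J φ) {a p : M} {b : N}
    (hp : p ∈ (extChartAt I a).source) (hb : φ p ∈ (extChartAt J b).source)
    (u v : TangentSpace I p) :
    chartDeriv J b (φ p) (secondForm I J φ p u v)
      = RiemLocal.secondForm (metricInChart I a) (metricInChart J b) (coordMap I J φ a b)
          (extChartAt I a p) (chartDeriv I a p u) (chartDeriv I a p v) := by
  have hpp := mem_extChartAt_target (I := I) p
  have hsymm : (extChartAt I p).symm (extChartAt I p p) = p := extChartAt_to_inv p
  have e1 : coordMap I J φ p (φ p) (extChartAt I p p) = extChartAt J (φ p) (φ p) := by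
    simp [coordMap]
  have e2 : coordMap I I id p a (extChartAt I p p) = extChartAt I a p := by
    simp [coordMap]
  have e3 : coordMap J J id (φ p) b (extChartAt J (φ p) (φ p)) = extChartAt J b (φ p) := by
    simp [coordMap]
  have hg := isMetricNear_metricInChart hpp
  have hG := isMetricNear_metricInChart (mem_extChartAt_target (I := J) (φ p))
  have hτ : IsIsometricNear (metricInChart I p) (metricInChart I a) (coordMap I I id p a)
      (extChartAt I p p) :=
    isIsometricNear_coordMap isIsometricImmersion_id hpp (by simpa only [hsymm, id_eq] using hp)
  have hσ : IsIsometricNear (metricInChart J (φ p)) (metricInChart J b)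
      (coordMap J J id (φ p) b) (extChartAt J (φ p) (φ p)) :=
    isIsometricNear_coordMap isIsometricImmersion_id (mem_extChartAt_target _)
      (by simpa only [extChartAt_to_inv, id_eq] using hb)
  have hcomp : coordMap I J φ a b ∘ coordMap I I id p a
      =ᶠ[𝓝 (extChartAt I p p)] coordMap J J id (φ p) b ∘ coordMap I J φ p (φ p) := by
    filter_upwards [eventually_mem_source isIsometricImmersion_id hpp (b := a)
      (by simpa only [hsymm, id_eq] using hp), eventually_mem_source hφ hpp (b := φ p)
      (by simp only [hsymm, mem_extChartAt_source])] with z hz1 hz2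
    have h1 := (extChartAt I a).left_inv hz1.2
    simp only [id_eq] at h1
    simp only [coordMap, Function.comp_apply, id_eq]
    rw [h1, (extChartAt J (φ p)).left_inv hz2.2]
  have key := secondForm_coordChange (f := coordMap I J φ p (φ p)) (f₀ := coordMap I J φ a b)
    hg (by rw [e2]; exact isMetricNear_metricInChart ((extChartAt I a).map_source hp))
    (by rw [e1]; exact hG)
    (by rw [e1, e3]; exact isMetricNear_metricInChart ((extChartAt J b).map_source hb))
    hτ (by rw [e1]; exact hσ) (hτ.surjective hg) (by rw [e1]; exact hσ.surjective hG)
    (isIsometricNear_coordMap hφ hpp (by simp only [hsymm, mem_extChartAt_source])).isSmoothNear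
    (by
      rw [e2]
      exact (isIsometricNear_coordMap hφ ((extChartAt I a).map_source hp)
        (by rwa [(extChartAt I a).left_inv hp])).isSmoothNear)
    hcomp u v
  rw [e1, e2, fderiv_coordMap_id hp, fderiv_coordMap_id hp] at key
  rw [← key]
  exact (fderiv_coordMap_id hb _).symm

theorem isOrthonormalFrame_chartDeriv {a p : M} (hp : p ∈ (extChartAt I a).source) {ι : Type*}
    [Fintype ι] (e : OrthonormalBasis ι ℝ (TangentSpace I p)) :
    IsOrthonormalFrame (metricInChart I a) (extChartAt I a p) (fun i ↦ chartDeriv I a p (e i)) where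
  sum_eq x := by
    obtain ⟨x, rfl⟩ := chartDeriv_surjective hp x
    simp only [metricInChart_chartDeriv hp]
    conv_rhs => rw [← e.sum_repr' x]
    simp
  self_eq i := by
    rw [metricInChart_chartDeriv hp, e.inner_eq_one]

theorem chartDeriv_meanCurvature (hφ : IsIsometricImmersion I J φ) {a p : M} {b : N}
    (hp : p ∈ (extChartAt I a).source) (hb : φ p ∈ (extChartAt J b).source) :
    chartDeriv J b (φ p) (meanCurvature I J φ p)
      = RiemLocal.meanCurvature (metricInChart I a) (metricInChart J b) (coordMap I J φ a b)
          (extChartAt I a p) := by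
  have ha := (extChartAt I a).map_source hp
  rw [RiemLocal.meanCurvature_eq (isMetricNear_metricInChart ha)
    (contMDiffAt_coordMap hφ ha (by rwa [(extChartAt I a).left_inv hp]))
    (isOrthonormalFrame_chartDeriv hp (stdOrthonormalBasis ℝ (TangentSpace I p)))]
  simp only [← chartDeriv_secondForm hφ hp hb]
  rw [meanCurvature, map_smul, map_sum]

end immersion

end Riem

namespace Riem

open RiemLocal

variable {E : Type*} [NormedAddCommGroup E] [NormedSpace ℝ E] [FiniteDimensional ℝ E]
  {H : Type*} [TopologicalSpace H] {I : ModelWithCorners ℝ E H} [I.Boundaryless]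
  {M : Type*} [TopologicalSpace M] [ChartedSpace H M] [IsManifold I ∞ M]
  [Bundle.RiemannianBundle (fun x : M ↦ TangentSpace I x)]
  {F : Type*} [NormedAddCommGroup F] [NormedSpace ℝ F] [FiniteDimensional ℝ F]
  {H' : Type*} [TopologicalSpace H'] {J : ModelWithCorners ℝ F H'} [J.Boundaryless]
  {N : Type*} [TopologicalSpace N] [ChartedSpace H' N] [IsManifold J ∞ N]
  [Bundle.RiemannianBundle (fun p : N ↦ TangentSpace J p)]
  {φ : M → N}
  [IsContMDiffRiemannianBundle I ∞ E (fun x : M ↦ TangentSpace I x)]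
  [IsContMDiffRiemannianBundle J ∞ F (fun x : N ↦ TangentSpace J x)]

theorem isIsometricNear_writtenInExtChartAt (hφ : IsIsometricImmersion I J φ) (x : M) :
    IsIsometricNear (metricInChart I x) (metricInChart J (φ x)) (writtenInExtChartAt I J x φ)
      (extChartAt I x x) :=
  isIsometricNear_coordMap hφ (mem_extChartAt_target x)
    (by simp only [extChartAt_to_inv, mem_extChartAt_source])

theorem isMetricNear_self (x : M) : IsMetricNear (metricInChart I x) (extChartAt I x x) :=
  isMetricNear_metricInChart (mem_extChartAt_target x)

theorem writtenInExtChartAt_self (x : M) :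
    writtenInExtChartAt I J x φ (extChartAt I x x) = extChartAt J (φ x) (φ x) := by
  simp [writtenInExtChartAt]

theorem isMetricNear_writtenInExtChartAt (x : M) : IsMetricNear (metricInChart J (φ x))
    (writtenInExtChartAt I J x φ (extChartAt I x x)) := by
  rw [writtenInExtChartAt_self]
  exact isMetricNear_self _

theorem eventually_mem_source_self (hφ : IsIsometricImmersion I J φ) (x : M) :
    ∀ᶠ z in 𝓝 (extChartAt I x x), z ∈ (extChartAt I x).target ∧
      φ ((extChartAt I x).symm z) ∈ (extChartAt J (φ x)).source :=
  eventually_mem_source hφ (mem_extChartAt_target x)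
    (by simp only [extChartAt_to_inv, mem_extChartAt_source])

theorem sectionInCharts_meanCurvature (hφ : IsIsometricImmersion I J φ) (x : M) :
    sectionInCharts I J φ (meanCurvature I J φ) x =ᶠ[𝓝 (extChartAt I x x)]
      RiemLocal.meanCurvature (metricInChart I x) (metricInChart J (φ x))
        (writtenInExtChartAt I J x φ) := by
  filter_upwards [eventually_mem_source_self hφ x] with z hz
  have h := chartDeriv_meanCurvature hφ ((extChartAt I x).map_target hz.1) hz.2
  rw [(extChartAt I x).right_inv hz.1] at h
  exact h

theorem norm_sq_meanCurvature (hφ : IsIsometricImmersion I J φ) (x : M) :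
    (fun p ↦ ‖meanCurvature I J φ p‖ ^ 2) ∘ (extChartAt I x).symm =ᶠ[𝓝 (extChartAt I x x)]
      fun z ↦ metricInChart J (φ x) (writtenInExtChartAt I J x φ z)
        (sectionInCharts I J φ (meanCurvature I J φ) x z)
        (sectionInCharts I J φ (meanCurvature I J φ) x z) := by
  filter_upwards [eventually_mem_source_self hφ x] with z hz
  have h := metricInChart_chartDeriv hz.2 (meanCurvature I J φ ((extChartAt I x).symm z))
    (meanCurvature I J φ ((extChartAt I x).symm z))
  rw [real_inner_self_eq_norm_sq] at h
  exact h.symm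

theorem contMDiff_norm_sq_meanCurvature (hφ : IsIsometricImmersion I J φ) :
    ContMDiff I 𝓘(ℝ, ℝ) ∞ (fun x ↦ ‖meanCurvature I J φ x‖ ^ 2) := by
  intro x
  have hf := isIsometricNear_writtenInExtChartAt hφ x
  have hV := (isSmoothNear_meanCurvature (isMetricNear_self (I := I) x)
    (isMetricNear_writtenInExtChartAt x) hf.isSmoothNear).congr (sectionInCharts_meanCurvature hφ x)
  have h1 : ContDiffAt ℝ ∞ (fun z ↦ metricInChart J (φ x) (writtenInExtChartAt I J x φ z)
        (sectionInCharts I J φ (meanCurvature I J φ) x z)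
        (sectionInCharts I J φ (meanCurvature I J φ) x z)) (extChartAt I x x) :=
    (((isMetricNear_writtenInExtChartAt x).contDiffAt.comp _ hf.contDiffAt).clm_apply
      hV.contDiffAt).clm_apply hV.contDiffAt
  have h2 := (h1.congr_of_eventuallyEq (norm_sq_meanCurvature hφ x)).contMDiffAt.comp x
    (contMDiffAt_extChartAt (n := ∞) (I := I) (x := x))
  refine h2.congr_of_eventuallyEq ?_
  filter_upwards [extChartAt_source_mem_nhds (I := I) x] with p hp
  exact congrArg (fun p ↦ ‖meanCurvature I J φ p‖ ^ 2) ((extChartAt I x).left_inv hp).symm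

theorem sectionInCharts_self (V : (x : M) → TangentSpace J (φ x)) (x : M) :
    sectionInCharts I J φ V x (extChartAt I x x) = V x := by
  have h : ∀ p, p = x → chartDeriv J (φ x) (φ p) (V p) = V x := by
    rintro p rfl
    exact chartDeriv_self _ _
  exact h _ (extChartAt_to_inv x)

theorem metricInChart_writtenInExtChartAt (x : M) (u v : TangentSpace J (φ x)) :
    metricInChart J (φ x) (writtenInExtChartAt I J x φ (extChartAt I x x)) u v = inner ℝ u v := by
  rw [writtenInExtChartAt_self]
  exact metricInChart_self _ u v

theorem isOrthonormalFrame_self (x : M) {ι : Type*} [Fintype ι]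
    (e : OrthonormalBasis ι ℝ (TangentSpace I x)) :
    IsOrthonormalFrame (E := E) (metricInChart I x) (extChartAt I x x) (fun i ↦ e i) := by
  have h := isOrthonormalFrame_chartDeriv (mem_extChartAt_source (I := I) x) e
  simp only [chartDeriv_self] at h
  exact h

theorem inner_meanCurvature_mfderiv (hφ : IsIsometricImmersion I J φ) (x : M)
    (w : TangentSpace I x) :
    inner ℝ (meanCurvature I J φ x) (mfderiv I J φ x w) = 0 := by
  have h := meanCurvature_normal (isMetricNear_self (I := I) x) (isMetricNear_writtenInExtChartAt x)
    (isIsometricNear_writtenInExtChartAt hφ x) w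
  rw [← (sectionInCharts_meanCurvature hφ x).self_of_nhds, sectionInCharts_self] at h
  rw [← metricInChart_writtenInExtChartAt (I := I) x, ← h,
    ((hφ.contMDiff x).mdifferentiableAt (by simp)).mfderiv, I.range_eq_univ, fderivWithin_univ]
  rfl

theorem le_laplacian_of_nonneg (hφ : IsIsometricImmersion I J φ) (x : M)
    (h : 0 ≤ inner ℝ (roughLaplacian I J φ (meanCurvature I J φ) x) (meanCurvature I J φ x)) :
    2 * (Module.finrank ℝ E : ℝ) * ‖meanCurvature I J φ x‖ ^ 4
      ≤ laplacian I (fun y ↦ ‖meanCurvature I J φ y‖ ^ 2) x := by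
  rw [← metricInChart_writtenInExtChartAt (I := I) x] at h
  have key := le_sum_hessian (isMetricNear_self (I := I) x) (isMetricNear_writtenInExtChartAt x)
    (isIsometricNear_writtenInExtChartAt hφ x)
    (isOrthonormalFrame_self x (stdOrthonormalBasis ℝ (TangentSpace I x)))
    (sectionInCharts_meanCurvature hφ x) (by rw [Fintype.card_fin]; rfl)
    (by rw [sectionInCharts_self]; exact h)
  rw [sectionInCharts_self, metricInChart_writtenInExtChartAt, real_inner_self_eq_norm_sq,
    ← pow_mul] at key
  exact key.trans_eq (Finset.sum_congr rfl fun i _ ↦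
    (hessian_congr (norm_sq_meanCurvature hφ x) _ _).symm)

theorem curvature_add_left (x : M) (a b u v : TangentSpace I x) :
    curvature I x (a + b) u v = curvature I x a u v + curvature I x b u v := by
  have h : (a + b : TangentSpace I x) = (HAdd.hAdd (α := E) (β := E) (γ := E) a b) := rfl
  have h1 := (isMetricNear_self (I := I) x).curvature_add_left (E := E) a b u v
  have h2 := congrArg (fun s : E ↦ RiemLocal.curvature (E := E) (metricInChart I x)
    (extChartAt I x x) s u v) h
  exact h2.trans h1

theorem curvature_smul_left (x : M) (c : ℝ) (a u v : TangentSpace I x) :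
    curvature I x (c • a) u v = c • curvature I x a u v := by
  have h : (c • a : TangentSpace I x) = (HSMul.hSMul (α := ℝ) (β := E) (γ := E) c a) := rfl
  have h1 := (isMetricNear_self (I := I) x).curvature_smul_left (E := E) c a u v
  have h2 := congrArg (fun s : E ↦ RiemLocal.curvature (E := E) (metricInChart I x)
    (extChartAt I x x) s u v) h
  exact h2.trans h1

theorem inner_curvature_pair (x : M) (u v : TangentSpace I x) :
    inner ℝ (curvature I x u v v) u = inner ℝ (curvature I x v u u) v := by
  have h := (isMetricNear_self (I := I) x).curvature_pair (E := E) u v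
  have h1 := metricInChart_self x (curvature I x u v v) u
  have h2 := metricInChart_self x (curvature I x v u u) v
  exact h1.symm.trans (h.trans h2)

/-- The Ricci curvature is the trace of the curvature operator in any orthonormal basis. -/
theorem ricci_eq_sum (x : M) (u v : TangentSpace I x) {ι : Type*} [Fintype ι]
    (e : OrthonormalBasis ι ℝ (TangentSpace I x)) :
    ricci I x u v = ∑ a, inner ℝ (curvature I x (e a) u v) (e a) := by
  let T : TangentSpace I x →ₗ[ℝ] TangentSpace I x :=
    { toFun := fun w ↦ curvature I x w u v
      map_add' := fun a b ↦ curvature_add_left x a b u v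
      map_smul' := fun c a ↦ curvature_smul_left x c a u v }
  have h1 := (T.trace_eq_sum_inner (stdOrthonormalBasis ℝ (TangentSpace I x))).symm.trans
    (T.trace_eq_sum_inner e)
  exact (Finset.sum_congr rfl fun a _ ↦ real_inner_comm _ _).trans
    (h1.trans (Finset.sum_congr rfl fun a _ ↦ real_inner_comm _ _))

/-- For a normal vector `ν` of a hypersurface, the curvature trace is the Ricci curvature. -/
theorem sum_inner_curvature (hφ : IsIsometricImmersion I J φ)
    (hdim : Module.finrank ℝ F = Module.finrank ℝ E + 1) (x : M) (ν : TangentSpace J (φ x))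
    (hν : ∀ w, inner ℝ ν (mfderiv I J φ x w) = 0) (hν0 : ν ≠ 0) {ι : Type*} [Fintype ι]
    (e : OrthonormalBasis ι ℝ (TangentSpace I x)) :
    ∑ i, inner ℝ (curvature J (φ x) ν (mfderiv I J φ x (e i)) (mfderiv I J φ x (e i))) ν
      = ricci J (φ x) ν ν := by
  classical
  have hn : ‖ν‖ ≠ 0 := norm_ne_zero_iff.2 hν0
  let b : Option ι → TangentSpace J (φ x) := fun o ↦
    o.elim (‖ν‖⁻¹ • ν) fun i ↦ mfderiv I J φ x (e i)
  have hb : Orthonormal ℝ b := by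
    rw [orthonormal_iff_ite]
    rintro (_ | i) (_ | j)
    · change inner ℝ (‖ν‖⁻¹ • ν) (‖ν‖⁻¹ • ν) = _
      rw [real_inner_smul_left, real_inner_smul_right, real_inner_self_eq_norm_sq, if_pos rfl]
      field_simp
    · simp [b, real_inner_smul_left, hν]
    · rw [real_inner_comm]
      simp [b, real_inner_smul_left, hν]
    · simp [b, hφ.inner_mfderiv, orthonormal_iff_ite.1 e.orthonormal]
  have hcard : Fintype.card (Option ι) = Module.finrank ℝ (TangentSpace J (φ x)) := by
    rw [Fintype.card_option, ← Module.finrank_eq_card_basis e.toBasis]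
    exact hdim.symm
  let b' : OrthonormalBasis (Option ι) ℝ (TangentSpace J (φ x)) :=
    OrthonormalBasis.mk hb (by
      rw [hb.linearIndependent.span_eq_top_of_card_eq_finrank' hcard])
  have hb' : ∀ o, b' o = b o := fun o ↦ by simp [b']
  rw [ricci_eq_sum (φ x) ν ν b', Fintype.sum_option]
  have h0 : curvature J (φ x) (b none) ν ν = 0 := by
    have h1 : curvature J (φ x) (b none) ν ν = ‖ν‖⁻¹ • curvature J (φ x) ν ν ν :=
      curvature_smul_left (φ x) ‖ν‖⁻¹ ν ν ν
    have h2 : curvature J (φ x) ν ν ν = 0 := RiemLocal.curvature_self (E := F) _ _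
    rw [h1, h2, smul_zero]
  rw [hb', h0, inner_zero_left, zero_add]
  exact Finset.sum_congr rfl fun i _ ↦ by rw [hb', inner_curvature_pair]; rfl

theorem inner_roughLaplacian_nonneg {lam : ℝ} (hlam : 0 ≤ lam) (hRic : RicciNonpos J N)
    (hφ : IsBiminimal I J φ lam) (hdim : Module.finrank ℝ F = Module.finrank ℝ E + 1) (x : M) :
    0 ≤ inner ℝ (roughLaplacian I J φ (meanCurvature I J φ) x) (meanCurvature I J φ x) := by
  set ν := meanCurvature I J φ x with hν
  have hn : ∀ w, inner ℝ ν (mfderiv I J φ x w) = 0 :=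
    inner_meanCurvature_mfderiv hφ.toIsIsometricImmersion x
  rcases eq_or_ne ν 0 with h0 | h0
  · rw [h0, inner_zero_right]
  have h1 := congrArg (inner ℝ · ν) (hφ.eq_zero x)
  have hmem : ν ∈ (mfderiv I J φ x).rangeᗮ := by
    rw [Submodule.mem_orthogonal']
    rintro _ ⟨w, rfl⟩
    exact hn w
  have h2 : ∀ w, inner ℝ (normalPart I J φ x w) ν = inner ℝ w ν := fun w ↦ by
    rw [normalPart, Submodule.inner_starProjection_left_eq_right,
      Submodule.starProjection_eq_self_iff.2 hmem]
  have h3 : inner ℝ (curvatureTrace I J φ (meanCurvature I J φ) x) ν = ricci J (φ x) ν ν := by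
    rw [curvatureTrace, sum_inner]
    exact sum_inner_curvature hφ.toIsIsometricImmersion hdim x ν hn h0 _
  simp only [inner_add_left, h2, inner_sub_left, inner_neg_left, h3, inner_zero_left, ← hν,
    real_inner_smul_left] at h1
  have h4 := hRic (φ x) ν
  have h5 := mul_nonneg hlam (real_inner_self_nonneg (x := ν))
  linarith

end Riem

end

theorem lemma5p1 {m : ℕ}
    {M : Type*} [TopologicalSpace M] [T2Space M] [SecondCountableTopology M]
    [ChartedSpace (EuclideanSpace ℝ (Fin m)) M] [IsManifold (𝓡 m) ∞ M]
    [Bundle.RiemannianBundle (fun x : M ↦ TangentSpace (𝓡 m) x)]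
    [IsContMDiffRiemannianBundle (𝓡 m) ∞ (EuclideanSpace ℝ (Fin m))
      (fun x : M ↦ TangentSpace (𝓡 m) x)]
    {N : Type*} [TopologicalSpace N] [T2Space N] [SecondCountableTopology N]
    [ChartedSpace (EuclideanSpace ℝ (Fin (m + 1))) N] [IsManifold (𝓡 (m + 1)) ∞ N]
    [Bundle.RiemannianBundle (fun p : N ↦ TangentSpace (𝓡 (m + 1)) p)]
    [IsContMDiffRiemannianBundle (𝓡 (m + 1)) ∞ (EuclideanSpace ℝ (Fin (m + 1)))
      (fun p : N ↦ TangentSpace (𝓡 (m + 1)) p)]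
    (hRic : Riem.RicciNonpos (𝓡 (m + 1)) N)
    (φ : M → N) (lam : ℝ) (hlam : 0 ≤ lam)
    (hφ : Riem.IsBiminimal (𝓡 m) (𝓡 (m + 1)) φ lam) :
    ContMDiff (𝓡 m) 𝓘(ℝ, ℝ) ∞ (fun x ↦ ‖Riem.meanCurvature (𝓡 m) (𝓡 (m + 1)) φ x‖ ^ 2) ∧
    ∀ x : M,
      Riem.laplacian (𝓡 m) (fun y ↦ ‖Riem.meanCurvature (𝓡 m) (𝓡 (m + 1)) φ y‖ ^ 2) x
        ≥ 2 * m * ‖Riem.meanCurvature (𝓡 m) (𝓡 (m + 1)) φ x‖ ^ 4 := by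
  refine ⟨Riem.contMDiff_norm_sq_meanCurvature hφ.toIsIsometricImmersion, fun x ↦ ?_⟩
  have h := Riem.le_laplacian_of_nonneg hφ.toIsIsometricImmersion x
    (Riem.inner_roughLaplacian_nonneg hlam hRic hφ (by simp) x)
  rwa [finrank_euclideanSpace_fin] at h
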